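/- A Stirling permutation of order $k$ is a word with letters $1,1,2,2,\dots,k,k$ in which every letter between the two occurrences of $i$ is greater than $i$, for each $i$. A Stirling permutation of the second kind of order $n$ is a sequence $\sigma$ of nonempty words (its cycles, $\sigma$ being written in standard cycle form) whose letters together form the multiset $\{1,1,2,2,\dots,n,n\}$, such that: the two copies of each $i\in\{1,\dots,n\}$ lie in the same cycle; each cycle is written with one of its smallest entries first, and the cycles are in increasing order of their smallest entries; and for each cycle $(c_1,\dots,c_{2k})$ the reduction of the word $c_1\cdots c_{2k}$ (replace its $i$th smallest distinct letter by $i$) is a Stirling permutation of order $k$. Let $\mathcal{Q}_n^2$ be the set of these; for $n=0$ it consists of the empty sequence only. An entry $c_i$ of a cycle $(c_1,\dots,c_{2k})$ is a cycle ascent plateau if $2\le i\le 2k-1$ and $c_{i-1}<c_i=c_{i+1}$. Let $\mathrm{cap}(\sigma)$ and $\mathrm{cyc}(\sigma)$ be the numbers of cycle ascent plateaus and of cycles of $\sigma$, and $$Q_n(x,q)=\sum_{\sigma\in\mathcal{Q}_n^2}x^{\mathrm{cap}(\sigma)}q^{\mathrm{cyc}(\sigma)}\in\mathbb{Z}[x,q].$$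 **Theorem.** $Q_0(x,q)=1$, and for all $n\ge 0$ $$Q_{n+1}(x,q)=(q+2nx)\,Q_n(x,q)+2x(1-x)\frac{\partial}{\partial x}Q_n(x,q).$$ Moreover, $$\sum_{n\ge 0}Q_n(x,q)\frac{z^n}{n!}=\left(\sqrt{\frac{x-1}{x-e^{2z(x-1)}}}\right)^{q}$$ as formal power series in $z$ over $K$, for any field $K$ of characteristic zero and any $x,q\in K$ with $x\neq 1$ (in particular for indeterminates $x,q$, with $K=\mathbb{Q}(x,q)$). Here the square root is the formal power series with constant term $1$ whose square is $\frac{x-1}{x-e^{2z(x-1)}}$, and $F^q=\sum_{k\ge0}\binom{q}{k}(F-1)^k$ for a series $F$ with constant term $1$. -/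

import Mathlib

namespace StirlingSecond

/-- `w` is a Stirling permutation of order `n`: a word with multiset of letters
`{1,1,2,2,…,n,n}` in which every letter `j` standing between the two occurrences of a letter `i`
satisfies `i < j`. (Such a `j` is exactly one for which `i, j, i` is a subsequence of `w`.) -/
structure IsStirlingPerm (n : ℕ) (w : List ℕ) : Prop where
  letters : (w : Multiset ℕ) = 2 • (Finset.Icc 1 n).val
  between : ∀ i j : ℕ, [i, j, i].Sublist w → i < j

/-- The reduction of a word: its letters are replaced by their ranks among the distinct letters
occurring in it, the smallest one becoming `1`; e.g. `33224547` becomes `22113435`. -/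
def red (w : List ℕ) : List ℕ :=
  w.map fun a => (w.toFinset.filter (· ≤ a)).card

/-- `σ`, a list of cycles each written as a word, is (the standard cycle form of) a Stirling
permutation of the second kind of order `n`. -/
structure IsStirlingPerm₂ (n : ℕ) (σ : List (List ℕ)) : Prop where
  /-- cycles are nonempty words -/
  cycle_ne_nil : ∀ c ∈ σ, c ≠ []
  /-- the letters of all cycles together form the multiset `{1,1,2,2,…,n,n}` -/
  letters : (σ.flatten : Multiset ℕ) = 2 • (Finset.Icc 1 n).val
  /-- the two copies of each letter are in the same cycle -/
  same_cycle : ∀ i ∈ Finset.Icc 1 n, ∃ c ∈ σ, c.count i = 2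
  /-- each cycle starts with one of its smallest letters -/
  min_first : ∀ c ∈ σ, ∀ a ∈ c, c.headI ≤ a
  /-- the cycles are in increasing order of their smallest letters -/
  increasing : σ.Pairwise fun c d => c.headI < d.headI
  /-- the reduction of each cycle is a Stirling permutation -/
  stirling : ∀ c ∈ σ, ∃ k, c.length = 2 * k ∧ IsStirlingPerm k (red c)

theorem finite_setOf_isStirlingPerm₂ (n : ℕ) : {σ | IsStirlingPerm₂ n σ}.Finite := by
  have h1 : {w : List ℕ | (w : Multiset ℕ) = 2 • (Finset.Icc 1 n).val}.Finite := by
    obtain ⟨l, hl⟩ := Quotient.exists_rep (2 • (Finset.Icc 1 n).val)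
    refine (List.finite_toSet l.permutations).subset ?_
    intro w hw
    have hw' : (w : Multiset ℕ) = (l : Multiset ℕ) := hw.trans hl.symm
    exact List.mem_permutations.2 (Multiset.coe_eq_coe.1 hw')
  have h2 : (Set.range fun c : Composition (2 * n) => c.blocks).Finite := Set.finite_range _
  refine ((h1.prod h2).preimage (f := fun σ : List (List ℕ) => (σ.flatten, σ.map List.length))
    ?_).subset ?_
  · intro σ _ τ _ h
    simp only [Prod.mk.injEq] at h
    exact List.eq_iff_flatten_eq.2 h
  · intro σ hσ
    refine ⟨hσ.letters, ⟨⟨σ.map List.length, ?_, ?_⟩, rfl⟩⟩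
    · intro i hi
      obtain ⟨c, hc, rfl⟩ := List.mem_map.1 hi
      exact List.length_pos_iff.2 (hσ.cycle_ne_nil c hc)
    · have := congrArg Multiset.card hσ.letters
      simpa [List.length_flatten] using this

/-- The finite set of Stirling permutations of the second kind of order `n`. -/
noncomputable def stirlingPerms₂ (n : ℕ) : Finset (List (List ℕ)) :=
  (finite_setOf_isStirlingPerm₂ n).toFinset

/-- The number of indices `i` with `c (i-1) < c i = c (i+1)` in a (non-cyclic) word `c`. -/
def capWord : List ℕ → ℕ
  | a :: b :: c :: l => (if a < b ∧ b = c then 1 else 0) + capWord (b :: c :: l)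
  | _ => 0

/-- The number of cycle ascent plateaus. -/
def cap (σ : List (List ℕ)) : ℕ := (σ.map capWord).sum

/-- The number of cycles. -/
def cyc (σ : List (List ℕ)) : ℕ := σ.length

/-- The polynomial `Q_n(x,q)`, where `x` is the variable `X 0` and `q` is the variable `X 1`. -/
noncomputable def Q (n : ℕ) : MvPolynomial (Fin 2) ℤ :=
  ∑ σ ∈ stirlingPerms₂ n, MvPolynomial.X 0 ^ cap σ * MvPolynomial.X 1 ^ cyc σ

/-- The exponential generating function `∑ Q_n(x,q) zⁿ / n!`, as a formal power series in `z`. -/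
noncomputable def egf {K : Type*} [Field K] (x q : K) : PowerSeries K :=
  PowerSeries.mk fun n => MvPolynomial.aeval ![x, q] (Q n) / (n.factorial : K)

/-- For a formal power series `F` with constant coefficient `1`, the power `F ^ a` with arbitrary
exponent `a`, that is `∑ k, (a choose k) (F - 1) ^ k`. -/
noncomputable def formalPow {K : Type*} [Field K] [CharZero K] (F : PowerSeries K) (a : K) :
    PowerSeries K :=
  (PowerSeries.binomialSeries K a).subst (F - 1)

end StirlingSecond

/-! Both claims rest on one insertion rule. With $N=n+1$, deleting the letter $N$ from an element of
$\mathcal{Q}_{n+1}^2$ leaves an element $\sigma$ of $\mathcal{Q}_n^2$. Nothing can stand between the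
two maximal letters, so $\sigma$ is recovered by inserting $NN$ after one of its $2n$ letters or by
adding a last cycle $(N,N)$ (`isStirlingPerm₂_succ_iff`). A plateau $a<b=b$ has two slots, after $a$
and after the first $b$, where $NN$ replaces it; distinct plateaus have disjoint slots, and any
other slot gains a plateau. So a monomial $x^iq^j$ produces
$x^iq^{j+1}+2i\,x^iq^j+2(n-i)\,x^{i+1}q^j$ (`sum_stirlingPerms₂_succ`). As $ix^i=x\,\partial_x x^i$,
this is the recurrence.

For the generating function no PDE is solved. If $u'=v'=2uv$ and $G'=qGv$, the same rule gives
$G^{(n)}=G\sum_\sigma u^{\mathrm{cap}}v^{n-\mathrm{cap}}q^{\mathrm{cyc}}$ (`iterate_derivative_eq`).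
With $u(0)=x$ and $v(0)=G(0)=1$, the constant term is $Q_n(x,q)$, so $G$ is the generating function.
For $H=\frac{x-1}{x-e^{2z(x-1)}}$, the choice $u=xH$, $v=1-x+xH$, $G=(\sqrt H)^q$ satisfies the
system. -/

namespace StirlingSecond

/-! ### Inserting a doubled letter -/

/-- The words obtained from `c` by inserting the factor `N N` right after one of its letters. -/
def insertWord (N : ℕ) : List ℕ → List (List ℕ)
  | [] => []
  | a :: l => (a :: N :: N :: l) :: (insertWord N l).map (a :: ·)

/-- The sequences of cycles obtained from `σ` by inserting the factor `N N` right after a letter of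
one of the cycles, or by appending the new cycle `(N, N)`. -/
def insertCycle (N : ℕ) : List (List ℕ) → List (List (List ℕ))
  | [] => [[[N, N]]]
  | c :: σ => (insertWord N c).map (· :: σ) ++ (insertCycle N σ).map (c :: ·)

theorem mem_insertWord {N : ℕ} {c w : List ℕ} :
    w ∈ insertWord N c ↔ ∃ u v, u ≠ [] ∧ c = u ++ v ∧ w = u ++ N :: N :: v := by
  induction c generalizing w with
  | nil => simp +contextual [insertWord]
  | cons a l ih =>
    simp only [insertWord, List.mem_cons, List.mem_map, ih]
    constructor
    · rintro (rfl | ⟨_, ⟨u, v, -, rfl, rfl⟩, rfl⟩)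
      · exact ⟨[a], l, by simp⟩
      · exact ⟨a :: u, v, by simp⟩
    · rintro ⟨_ | ⟨b, u⟩, v, h, h', rfl⟩
      · exact absurd rfl h
      · simp only [List.cons_append, List.cons.injEq] at h'
        obtain ⟨rfl, rfl⟩ := h'
        rcases u with _ | ⟨b, u⟩
        · simp
        · exact Or.inr ⟨_, ⟨b :: u, v, by simp, rfl, rfl⟩, rfl⟩

theorem mem_insertCycle {N : ℕ} {σ τ : List (List ℕ)} :
    τ ∈ insertCycle N σ ↔ τ = σ ++ [[N, N]] ∨
      ∃ s c t w, σ = s ++ c :: t ∧ w ∈ insertWord N c ∧ τ = s ++ w :: t := by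
  induction σ generalizing τ with
  | nil => simp [insertCycle]
  | cons c σ ih =>
    simp only [insertCycle, List.mem_append, List.mem_map, ih]
    constructor
    · rintro (⟨w, hw, rfl⟩ | ⟨_, rfl | ⟨s, d, t, w, rfl, hw, rfl⟩, rfl⟩)
      · exact Or.inr ⟨[], c, σ, w, rfl, hw, rfl⟩
      · simp
      · exact Or.inr ⟨c :: s, d, t, w, rfl, hw, rfl⟩
    · rintro (rfl | ⟨_ | ⟨e, s⟩, d, t, w, h, hw, rfl⟩)
      · simp
      · simp only [List.nil_append, List.cons.injEq] at h
        obtain ⟨rfl, rfl⟩ := h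
        exact Or.inl ⟨w, hw, rfl⟩
      · simp only [List.cons_append, List.cons.injEq] at h
        obtain ⟨rfl, rfl⟩ := h
        exact Or.inr ⟨_, Or.inr ⟨s, d, t, w, rfl, hw, rfl⟩, rfl⟩

/-- A new letter marks its place of insertion, so different places give different words. -/
theorem nodup_insertWord {N : ℕ} {c : List ℕ} (h : N ∉ c) : (insertWord N c).Nodup := by
  induction c with
  | nil => simp [insertWord]
  | cons a l ih =>
    simp only [List.mem_cons, not_or] at h
    refine List.nodup_cons.2 ⟨?_, (ih h.2).map (List.cons_injective)⟩
    simp only [List.mem_map, List.cons.injEq, true_and, exists_eq_right]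
    intro h'
    obtain ⟨_ | ⟨b, u⟩, v, hu, rfl, hw⟩ := mem_insertWord.1 h'
    · exact hu rfl
    · simp only [List.cons_append, List.cons.injEq] at hw
      exact h.2 (by simp [hw.1])

theorem nodup_insertCycle {N : ℕ} {σ : List (List ℕ)} (h : N ∉ σ.flatten) :
    (insertCycle N σ).Nodup := by
  induction σ with
  | nil => simp [insertCycle]
  | cons c σ ih =>
    simp only [List.flatten_cons, List.mem_append, not_or] at h
    refine List.nodup_append'.2 ⟨(nodup_insertWord h.1).map fun _ _ e => (List.cons.inj e).1,
      (ih h.2).map (List.cons_injective), ?_⟩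
    intro τ h1 h2
    obtain ⟨w, hw, rfl⟩ := List.mem_map.1 h1
    obtain ⟨_, -, e⟩ := List.mem_map.1 h2
    obtain ⟨rfl, -⟩ := List.cons.inj e
    obtain ⟨u, v, -, -, e⟩ := mem_insertWord.1 hw
    exact h.1 (by rw [e]; simp)

/-! ### Ascent plateaus under insertion -/

theorem capWord_cons_cons_max {a N : ℕ} {l : List ℕ} (ha : a < N) (hl : ∀ b ∈ l, b < N) :
    capWord (a :: N :: N :: l) = 1 + capWord l := by
  have h1 : capWord (N :: l) = capWord l := by
    match l, hl with
    | [], _ => rfl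
    | [_], _ => rfl
    | b :: c :: l, hl =>
      have := hl b (by simp)
      rw [capWord, if_neg (by omega), zero_add]
  have h2 : capWord (N :: N :: l) = capWord (N :: l) := by
    match l with
    | [] => rfl
    | b :: l => rw [capWord, if_neg (by omega), zero_add]
  rw [capWord, if_pos ⟨ha, rfl⟩, h2, h1]

theorem capWord_cons_self (b : ℕ) (l : List ℕ) : capWord (b :: b :: l) = capWord (b :: l) := by
  cases l with
  | nil => rfl
  | cons d l => rw [capWord, if_neg (by omega), zero_add]

/-- The ascent plateaus of the words in `insertWord N c`: each of the `2 * capWord c` places at an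
ascent plateau of `c` keeps their number, each of the other places adds one. -/
theorem sum_insertWord {N : ℕ} {c : List ℕ} (h : ∀ a ∈ c, a < N) :
    ∃ m, c.length = 2 * capWord c + m ∧
      ∀ {M : Type*} [AddCommMonoid M] (φ : ℕ → M),
        ((insertWord N c).map fun w => φ (capWord w)).sum =
          (2 * capWord c) • φ (capWord c) + m • φ (capWord c + 1) := by
  match c, h with
  | [], _ => exact ⟨0, rfl, by simp [insertWord, capWord]⟩
  | [a], h => exact ⟨1, rfl, by simp [insertWord, h a (by simp), capWord]⟩
  | [a, b], h =>
    refine ⟨2, rfl, fun {M} _ φ => ?_⟩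
    have ha := h a (by simp)
    have hb := h b (by simp)
    simp [insertWord, capWord, ha, hb, hb.ne, two_nsmul]
  | a :: b :: c :: l, h =>
    have ha := h a (by simp)
    have hb := h b (by simp)
    have hbcl : ∀ d ∈ b :: c :: l, d < N := fun d hd => h d (List.mem_cons_of_mem _ hd)
    have hcl : ∀ d ∈ c :: l, d < N := fun d hd => hbcl d (List.mem_cons_of_mem _ hd)
    have e1 := capWord_cons_cons_max ha hbcl
    have e2 := capWord_cons_cons_max hb hcl
    have e3 : capWord (a :: b :: N :: N :: c :: l) = 1 + capWord (c :: l) := by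
      rw [capWord, if_neg (by omega), e2, zero_add]
    have e4 : ∀ w ∈ insertWord N (c :: l), capWord (a :: b :: w) =
        (if a < b ∧ b = c then 1 else 0) + capWord (b :: w) ∧
        (b = c → capWord (b :: w) = capWord w) := by
      intro w hw
      obtain ⟨_ | ⟨d, u⟩, v, hu, hc, rfl⟩ := mem_insertWord.1 hw
      · exact absurd rfl hu
      · obtain ⟨rfl, -⟩ := List.cons.inj hc
        refine ⟨rfl, ?_⟩
        rintro rfl
        exact capWord_cons_self _ _
    -- At a plateau `a < b = c` the slots after `a` and `b` are its two neutral ones, so both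
    -- letters are stripped and the plateau becomes a constant shift of `φ`. Otherwise only `a` is
    -- stripped, and its slot gains a plateau.
    by_cases hp : a < b ∧ b = c
    · obtain ⟨m, hm, H⟩ := sum_insertWord hcl
      have e6 : capWord (b :: c :: l) = capWord (c :: l) := hp.2 ▸ capWord_cons_self _ _
      have e7 : capWord (a :: b :: c :: l) = 1 + capWord (c :: l) := by
        rw [capWord, if_pos hp, e6]
      refine ⟨m, by rw [List.length_cons, List.length_cons, hm, e7]; ring, fun {M} _ φ => ?_⟩
      have e5 : ((insertWord N (c :: l)).map fun w => φ (capWord (a :: b :: w))).sum =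
          ((insertWord N (c :: l)).map fun w => φ (1 + capWord w)).sum := by
        refine congrArg List.sum (List.map_congr_left fun w hw => ?_)
        rw [(e4 w hw).1, (e4 w hw).2 hp.2, if_pos hp]
      have e8 : insertWord N (a :: b :: c :: l) = (a :: N :: N :: b :: c :: l) ::
        (a :: b :: N :: N :: c :: l) :: (insertWord N (c :: l)).map (a :: b :: ·) := by
        simp [insertWord]
      rw [e8, List.map_cons, List.map_cons, List.map_map, List.sum_cons, List.sum_cons, e1, e3, e6,
        e7, Function.comp_def, e5, H fun k => φ (1 + k), mul_add, add_nsmul, mul_one, two_nsmul]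
      simp only [add_assoc]
    · obtain ⟨m, hm, H⟩ := sum_insertWord hbcl
      have e7 : capWord (a :: b :: c :: l) = capWord (b :: c :: l) := by
        rw [capWord, if_neg hp, zero_add]
      refine ⟨m + 1, by rw [List.length_cons, hm, e7]; ring, fun {M} _ φ => ?_⟩
      have e5 : ((insertWord N (b :: c :: l)).map fun w => φ (capWord (a :: w))).sum =
          ((insertWord N (b :: c :: l)).map fun w => φ (capWord w)).sum := by
        refine congrArg List.sum (List.map_congr_left fun w hw => ?_)
        rcases List.mem_cons.1 hw with rfl | hw
        · rw [e2, e3]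
        · obtain ⟨w, hw', rfl⟩ := List.mem_map.1 hw
          rw [(e4 w hw').1, if_neg hp, zero_add]
      rw [insertWord, List.map_cons, List.map_map, List.sum_cons, e1, e7, Function.comp_def, e5,
        H φ, add_comm 1, succ_nsmul]
      abel

/-- The joint distribution of ascent plateaus and cycles over `insertCycle N σ`. -/
theorem sum_insertCycle {N : ℕ} {σ : List (List ℕ)} (h : ∀ a ∈ σ.flatten, a < N) :
    ∃ m, σ.flatten.length = 2 * cap σ + m ∧
      ∀ {M : Type*} [AddCommMonoid M] (φ : ℕ → ℕ → M),
        ((insertCycle N σ).map fun τ => φ (cap τ) (cyc τ)).sum =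
          φ (cap σ) (cyc σ + 1) + (2 * cap σ) • φ (cap σ) (cyc σ) +
            m • φ (cap σ + 1) (cyc σ) := by
  induction σ with
  | nil => exact ⟨0, rfl, by simp [insertCycle, cap, cyc, capWord]⟩
  | cons c σ ih =>
    simp only [List.flatten_cons, List.mem_append] at h
    obtain ⟨m, hm, H⟩ := ih fun a ha => h a (Or.inr ha)
    obtain ⟨k, hk, I⟩ := sum_insertWord fun a ha => h a (Or.inl ha)
    have hcap : ∀ (d : List ℕ) τ, cap (d :: τ) = capWord d + cap τ := fun d τ => by simp [cap]
    have hcyc : ∀ (d : List ℕ) τ, cyc (d :: τ) = cyc τ + 1 := fun d τ => by simp [cyc]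
    refine ⟨k + m, by rw [List.flatten_cons, List.length_append, hm, hk, hcap]; ring,
      fun {M} _ φ => ?_⟩
    simp only [insertCycle, List.map_append, List.map_map, List.sum_append, Function.comp_def, hcap,
      hcyc]
    rw [I fun i => φ (i + cap σ) (cyc σ + 1), H fun i j => φ (capWord c + i) (j + 1)]
    simp only [mul_add, add_nsmul, add_right_comm _ 1 (cap σ), add_assoc]
    abel

/-! ### Reductions and conditions on the cycles themselves -/

theorem red_apply_lt {c : List ℕ} {a b : ℕ} (hb : b ∈ c) (h : a < b) :
    (c.toFinset.filter (· ≤ a)).card < (c.toFinset.filter (· ≤ b)).card := by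
  refine Finset.card_lt_card ⟨fun x hx => ?_, fun hs => ?_⟩
  · simp only [Finset.mem_filter] at hx ⊢
    exact ⟨hx.1, hx.2.trans h.le⟩
  · have : b ∈ c.toFinset.filter (· ≤ a) := hs (by simp [hb])
    simp only [Finset.mem_filter] at this
    omega

theorem red_apply_le (c : List ℕ) {a b : ℕ} (h : a ≤ b) :
    (c.toFinset.filter (· ≤ a)).card ≤ (c.toFinset.filter (· ≤ b)).card :=
  Finset.card_le_card (Finset.monotone_filter_right _ fun _ _ hx => hx.trans h)

theorem red_apply_injOn (c : List ℕ) :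
    Set.InjOn (fun a => (c.toFinset.filter (· ≤ a)).card) {a | a ∈ c} := by
  intro a ha b hb h
  rcases lt_trichotomy a b with hab | hab | hab
  · exact absurd h (red_apply_lt hb hab).ne
  · exact hab
  · exact absurd h (red_apply_lt ha hab).ne'

/-- The reduction of a word has the betweenness property of Stirling permutations if and only if the
word itself has. -/
theorem between_red_iff (c : List ℕ) :
    (∀ i j : ℕ, [i, j, i].Sublist (red c) → i < j) ↔
      ∀ i j : ℕ, [i, j, i].Sublist c → i < j := by
  constructor
  · intro h i j hs
    by_contra hij
    exact absurd (h _ _ (hs.map fun a => (c.toFinset.filter (· ≤ a)).card))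
      (red_apply_le c (not_lt.1 hij)).not_gt
  · intro h i j hs
    obtain ⟨l, hl, e⟩ := List.sublist_map_iff.1 hs
    have hlen : l.length = 3 := by simpa using (congrArg List.length e).symm
    obtain ⟨a, b, d, rfl⟩ := List.length_eq_three.1 hlen
    simp only [List.map_cons, List.map_nil, List.cons.injEq, and_true] at e
    obtain ⟨rfl, rfl, e⟩ := e
    have ha : a ∈ c := hl.subset (by simp)
    have hb : b ∈ c := hl.subset (by simp)
    have hd : d ∈ c := hl.subset (by simp)
    obtain rfl := red_apply_injOn c ha hd e
    exact red_apply_lt hb (h _ _ hl)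

/-- Ranks map the distinct letters injectively into `1, …, k`, with `k` their number, hence onto it.
The letter condition on a reduction is thus automatic once every letter occurs twice. -/
theorem coe_red_eq {c : List ℕ} (h : ∀ i ∈ c, c.count i = 2) :
    c.length = 2 * c.toFinset.card ∧
      (red c : Multiset ℕ) = 2 • (Finset.Icc 1 c.toFinset.card).val := by
  have hc : (c : Multiset ℕ) = 2 • c.toFinset.val := by
    ext a
    rw [Multiset.coe_count, Multiset.count_nsmul]
    by_cases ha : a ∈ c
    · rw [h a ha, Multiset.count_eq_one_of_mem c.toFinset.nodup (by simpa using ha)]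
    · rw [List.count_eq_zero_of_not_mem ha, Multiset.count_eq_zero_of_notMem (by simpa using ha)]
  refine ⟨by simpa [List.card_toFinset] using congrArg Multiset.card hc, ?_⟩
  have himg : c.toFinset.image (fun a => (c.toFinset.filter (· ≤ a)).card) =
      Finset.Icc 1 c.toFinset.card := by
    refine Finset.eq_of_subset_of_card_le ?_ ?_
    · intro k hk
      obtain ⟨a, ha, rfl⟩ := Finset.mem_image.1 hk
      refine Finset.mem_Icc.2 ⟨Finset.card_pos.2 ⟨a, by simpa using ha⟩, ?_⟩
      exact Finset.card_le_card (Finset.filter_subset _ _)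
    · rw [Finset.card_image_of_injOn fun a ha b hb e =>
        red_apply_injOn c (by simpa using ha) (by simpa using hb) e]
      simp
  rw [red, ← Multiset.map_coe, hc, Multiset.map_nsmul, ← himg, Finset.image_val_of_injOn]
  exact fun a ha b hb e => red_apply_injOn c (by simpa using ha) (by simpa using hb) e

/-- A description of Stirling permutations of the second kind that does not mention reductions. -/
theorem isStirlingPerm₂_iff {n : ℕ} {σ : List (List ℕ)} :
    IsStirlingPerm₂ n σ ↔
      (∀ c ∈ σ, c ≠ []) ∧ (∀ i, σ.flatten.count i = if i ∈ Finset.Icc 1 n then 2 else 0) ∧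
      (∀ c ∈ σ, ∀ i ∈ c, c.count i = 2) ∧ (∀ c ∈ σ, ∀ a ∈ c, c.headI ≤ a) ∧
      (σ.Pairwise fun c d => c.headI < d.headI) ∧
      ∀ c ∈ σ, ∀ i j : ℕ, [i, j, i].Sublist c → i < j := by
  have hcount : (σ.flatten : Multiset ℕ) = 2 • (Finset.Icc 1 n).val ↔
      ∀ i, σ.flatten.count i = if i ∈ Finset.Icc 1 n then 2 else 0 := by
    rw [Multiset.ext]
    refine forall_congr' fun i => ?_
    rw [Multiset.coe_count, Multiset.count_nsmul, Multiset.count_eq_of_nodup (Finset.nodup _)]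
    simp only [Finset.mem_val]
    split_ifs <;> simp
  constructor
  · intro h
    have hl := hcount.1 h.letters
    refine ⟨h.cycle_ne_nil, hl, fun c hc i hi => ?_, h.min_first, h.increasing, fun c hc => ?_⟩
    · have hi' : i ∈ Finset.Icc 1 n := by
        by_contra hn
        have := hl i
        rw [if_neg hn, List.count_eq_zero] at this
        exact this (List.mem_flatten.2 ⟨c, hc, hi⟩)
      obtain ⟨d, hd, hdi⟩ := h.same_cycle i hi'
      obtain ⟨s, t, rfl⟩ := List.append_of_mem hd
      have := hl i
      rw [if_pos hi', List.flatten_append, List.flatten_cons, List.count_append, List.count_append,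
        hdi] at this
      have hs : i ∉ s.flatten := List.count_eq_zero.1 (by omega)
      have ht : i ∉ t.flatten := List.count_eq_zero.1 (by omega)
      simp only [List.mem_append, List.mem_cons] at hc
      rcases hc with hc | rfl | hc
      · exact absurd (List.mem_flatten.2 ⟨c, hc, hi⟩) hs
      · exact hdi
      · exact absurd (List.mem_flatten.2 ⟨c, hc, hi⟩) ht
    · obtain ⟨k, -, hk⟩ := h.stirling c hc
      exact (between_red_iff c).1 hk.between
  · rintro ⟨h1, h2, h3, h4, h5, h6⟩
    refine ⟨h1, hcount.2 h2, fun i hi => ?_, h4, h5, fun c hc => ?_⟩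
    · have hm : i ∈ σ.flatten := List.count_pos_iff.1 (by rw [h2, if_pos hi]; norm_num)
      obtain ⟨c, hc, hi⟩ := List.mem_flatten.1 hm
      exact ⟨c, hc, h3 c hc i hi⟩
    · obtain ⟨hl, hr⟩ := coe_red_eq (h3 c hc)
      exact ⟨_, hl, hr, (between_red_iff c).2 (h6 c hc)⟩

theorem mem_stirlingPerms₂ {n : ℕ} {σ : List (List ℕ)} :
    σ ∈ stirlingPerms₂ n ↔ IsStirlingPerm₂ n σ := by
  simp [stirlingPerms₂]

theorem IsStirlingPerm₂.mem_flatten_iff {n : ℕ} {σ : List (List ℕ)} (h : IsStirlingPerm₂ n σ)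
    {a : ℕ} : a ∈ σ.flatten ↔ 1 ≤ a ∧ a ≤ n := by
  rw [← List.count_pos_iff, (isStirlingPerm₂_iff.1 h).2.1, ← Finset.mem_Icc]
  split_ifs with h <;> simp [h]

theorem IsStirlingPerm₂.length_flatten {n : ℕ} {σ : List (List ℕ)} (h : IsStirlingPerm₂ n σ) :
    σ.flatten.length = 2 * n := by
  simpa using congrArg Multiset.card h.letters

/-! ### Removing and inserting the largest letter -/

/-- Remove all letters `N`, and then the empty cycles. -/
def removeLetter (N : ℕ) (σ : List (List ℕ)) : List (List ℕ) :=
  (σ.map (List.filter (· ≠ N))).filter (· ≠ [])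

theorem filter_ne_eq_self {N : ℕ} {c : List ℕ} (h : N ∉ c) : c.filter (· ≠ N) = c :=
  List.filter_eq_self.2 fun a ha => by simpa using fun e : a = N => h (e ▸ ha)

theorem removeLetter_eq_self {N : ℕ} {σ : List (List ℕ)} (h : N ∉ σ.flatten)
    (h' : ∀ c ∈ σ, c ≠ []) : removeLetter N σ = σ := by
  have : σ.map (List.filter (· ≠ N)) = σ := by
    conv_rhs => rw [← List.map_id σ]
    exact List.map_congr_left fun c hc =>
      filter_ne_eq_self fun hN => h (List.mem_flatten.2 ⟨c, hc, hN⟩)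
  rw [removeLetter, this, List.filter_eq_self]
  simpa using h'

theorem filter_ne_of_mem_insertWord {N : ℕ} {c w : List ℕ} (h : N ∉ c) (hw : w ∈ insertWord N c) :
    w.filter (· ≠ N) = c := by
  obtain ⟨u, v, -, rfl, rfl⟩ := mem_insertWord.1 hw
  rw [← filter_ne_eq_self h]
  simp

/-- Removal undoes insertion, so different `σ` have disjoint sets of insertions. Discarding empty
cycles handles the appended `[N, N]`. -/
theorem removeLetter_of_mem_insertCycle {N : ℕ} {σ τ : List (List ℕ)} (h : N ∉ σ.flatten)
    (h' : ∀ c ∈ σ, c ≠ []) (hτ : τ ∈ insertCycle N σ) : removeLetter N τ = σ := by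
  rw [← removeLetter_eq_self h h']
  rcases mem_insertCycle.1 hτ with rfl | ⟨s, c, t, w, rfl, hw, rfl⟩
  · rw [removeLetter_eq_self h h']
    conv_rhs => rw [← removeLetter_eq_self h h']
    simp [removeLetter]
  · have hc : N ∉ c := fun hN => h (List.mem_flatten.2 ⟨c, by simp, hN⟩)
    simp only [removeLetter, List.map_append, List.map_cons, filter_ne_of_mem_insertWord hc hw,
      filter_ne_eq_self hc]

theorem between_insert {N : ℕ} {u v : List ℕ} (hN : ∀ a ∈ u ++ v, a < N)
    (h : ∀ i j : ℕ, [i, j, i].Sublist (u ++ v) → i < j) (i j : ℕ)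
    (hs : [i, j, i].Sublist (u ++ N :: N :: v)) : i < j := by
  have hu : N ∉ u := fun hu => lt_irrefl _ (hN N (by simp [hu]))
  have hv : N ∉ v := fun hv => lt_irrefl _ (hN N (by simp [hv]))
  by_cases hi : i = N
  · subst hi
    exfalso
    -- A pattern `N j N` would need an occurrence of `N` in `u` or `v`, as the two inserted copies
    -- are adjacent.
    obtain ⟨l₁, l₂, e, h1, h2⟩ := List.sublist_append_iff.1 hs
    rcases l₁ with _ | ⟨b, l₁⟩
    · rw [List.nil_append] at e
      subst e
      rw [List.cons_sublist_cons] at h2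
      rcases h2 with _ | ⟨_, h2⟩ | ⟨_, h2⟩
      all_goals exact hv (h2.subset (by simp))
    · obtain ⟨rfl, -⟩ := List.cons.inj e
      exact hu (h1.subset (by simp))
  · have hi' : i ∈ u ++ v := by
      have : i ∈ u ++ N :: N :: v := hs.subset (by simp)
      simpa [hi] using this
    by_cases hj : j = N
    · exact hj ▸ hN i hi'
    · refine h i j ?_
      have := hs.filter (· ≠ N)
      rw [← filter_ne_eq_self (fun hm => (List.mem_append.1 hm).elim hu hv : N ∉ u ++ v)]
      simpa [hi, hj] using this

/-- A letter between the two copies of `N` would have to exceed the maximum. -/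
theorem exists_eq_append_max {N : ℕ} {w : List ℕ} (hN : ∀ a ∈ w, a ≤ N) (hw : w.count N = 2)
    (h : ∀ i j : ℕ, [i, j, i].Sublist w → i < j) :
    ∃ u v, w = u ++ N :: N :: v ∧ N ∉ u ++ v := by
  obtain ⟨u, t, rfl, hu⟩ := List.eq_append_cons_of_mem 
    (List.count_pos_iff.1 (by omega : 0 < w.count N))
  rw [List.count_append, List.count_eq_zero.2 hu, List.count_cons_self] at hw
  obtain ⟨m, v, rfl, hm⟩ := List.eq_append_cons_of_mem 
    (List.count_pos_iff.1 (by omega : 0 < t.count N))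
  rw [List.count_append, List.count_cons_self] at hw
  rcases m with _ | ⟨j, m⟩
  · refine ⟨u, v, rfl, ?_⟩
    have : N ∉ v := List.count_eq_zero.1 (by omega)
    simp [hu, this]
  · have h1 := hN j (by simp)
    have h2 := h N j (by
      refine List.Sublist.trans ?_ (List.sublist_append_right _ _)
      refine List.Sublist.cons_cons _ (List.Sublist.cons_cons _ ?_)
      simp)
    omega

theorem count_add_iff {n : ℕ} {l l' : List ℕ} (hl : ∀ a ∈ l, a < n + 1)
    (h : ∀ i, l'.count i = l.count i + if i = n + 1 then 2 else 0) :
    (∀ i, l'.count i = if i ∈ Finset.Icc 1 (n + 1) then 2 else 0) ↔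
      ∀ i, l.count i = if i ∈ Finset.Icc 1 n then 2 else 0 := by
  refine forall_congr' fun i => ?_
  rw [h]
  by_cases hi : i = n + 1
  · have : l.count i = 0 := List.count_eq_zero.2 fun hm => (hl i hm).ne hi
    rw [this, if_pos hi, if_pos (by simp [hi]), if_neg (by simp [hi])]
    simp
  · have : i ∈ Finset.Icc 1 (n + 1) ↔ i ∈ Finset.Icc 1 n := by
      simp only [Finset.mem_Icc]; omega
    simp only [hi, this, if_false, add_zero]

theorem isStirlingPerm₂_append_iff {n : ℕ} {σ : List (List ℕ)} (hσ : ∀ a ∈ σ.flatten, a < n + 1) :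
    IsStirlingPerm₂ (n + 1) (σ ++ [[n + 1, n + 1]]) ↔ IsStirlingPerm₂ n σ := by
  rw [isStirlingPerm₂_iff, isStirlingPerm₂_iff, count_add_iff (l := σ.flatten) hσ]
  · simp only [List.forall_mem_append, List.forall_mem_singleton, List.pairwise_append]
    refine and_congr (by simp) (and_congr Iff.rfl (and_congr (by simp) (and_congr (by simp)
      (and_congr ?_ ?_))))
    · have hlt : ∀ c ∈ σ, c.headI < n + 1 := by
        rintro (_ | ⟨b, c⟩) hc
        · exact Nat.succ_pos n
        · exact hσ b (List.mem_flatten.2 ⟨_, hc, List.mem_cons_self⟩)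
      simpa using fun _ => hlt
    · exact and_iff_left fun i j hs => absurd hs.length_le (by simp)
  · intro i
    simp [List.count_cons]
    split_ifs <;> omega

/-- As `u` is nonempty, the first letter of the cycle is unchanged, and with it the order of the
cycles. -/
theorem isStirlingPerm₂_insert_iff {n : ℕ} {s t : List (List ℕ)} {u v : List ℕ} (hu : u ≠ [])
    (hσ : ∀ a ∈ (s ++ (u ++ v) :: t).flatten, a < n + 1) :
    IsStirlingPerm₂ (n + 1) (s ++ (u ++ (n + 1) :: (n + 1) :: v) :: t) ↔
      IsStirlingPerm₂ n (s ++ (u ++ v) :: t) := by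
  have huv : ∀ a ∈ u ++ v, a < n + 1 := fun a ha => hσ a (List.mem_flatten.2 ⟨_, by simp, ha⟩)
  have hcount : ∀ i, (u ++ (n + 1) :: (n + 1) :: v).count i =
      (u ++ v).count i + if i = n + 1 then 2 else 0 := by
    intro i
    simp only [List.count_append, List.count_cons, beq_iff_eq, eq_comm (a := n + 1)]
    split_ifs <;> omega
  have hhead : (u ++ (n + 1) :: (n + 1) :: v).headI = (u ++ v).headI := by
    cases u with
    | nil => exact absurd rfl hu
    | cons b u => rfl
  have hheadmem : (u ++ v).headI ∈ u ++ v := by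
    cases u with
    | nil => exact absurd rfl hu
    | cons b u => simp
  rw [isStirlingPerm₂_iff, isStirlingPerm₂_iff, count_add_iff hσ]
  · simp only [List.forall_mem_append, List.forall_mem_cons]
    refine and_congr (by simp [hu]) (and_congr Iff.rfl (and_congr (and_congr Iff.rfl
      (and_congr ?_ Iff.rfl)) (and_congr (and_congr Iff.rfl (and_congr ?_ Iff.rfl))
      (and_congr ?_ (and_congr Iff.rfl (and_congr ?_ Iff.rfl))))))
    · simp only [hcount]
      have h0 : (u ++ v).count (n + 1) = 0 :=
        List.count_eq_zero.2 fun hm => lt_irrefl _ (huv _ hm)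
      rw [h0]
      simp only [if_true, zero_add, true_and]
      refine and_congr (forall₂_congr fun i hi => ?_) (forall₂_congr fun i hi => ?_)
      all_goals rw [if_neg (huv i (by simp [hi])).ne, add_zero]
    · have := (huv _ hheadmem).le
      simp only [hhead]
      tauto
    · have : ∀ σ : List (List ℕ), (σ.Pairwise fun c d => c.headI < d.headI) ↔
        (σ.map List.headI).Pairwise (· < ·) := fun σ => List.pairwise_map.symm
      rw [this, this]
      simp only [List.map_append, List.map_cons, hhead]
    · refine ⟨fun h i j hs => h i j (hs.trans ?_), between_insert huv⟩
      exact (List.Sublist.refl u).append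
        ((List.sublist_cons_self _ _).trans (List.sublist_cons_self _ _))
  · intro i
    simp only [List.flatten_append, List.flatten_cons, List.count_append (l₁ := s.flatten),
      List.count_append (l₂ := t.flatten), hcount]
    ring

theorem isStirlingPerm₂_succ_iff {n : ℕ} {τ : List (List ℕ)} :
    IsStirlingPerm₂ (n + 1) τ ↔ ∃ σ, IsStirlingPerm₂ n σ ∧ τ ∈ insertCycle (n + 1) σ := by
  constructor
  · intro h
    obtain ⟨w, hw, hNw⟩ := h.same_cycle (n + 1) (by simp)
    have hle : ∀ {a}, a ∈ τ.flatten → a ≤ n + 1 := fun ha => (h.mem_flatten_iff.1 ha).2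
    have h' := isStirlingPerm₂_iff.1 h
    obtain ⟨u, v, rfl, huv⟩ := exists_eq_append_max
      (fun a ha => hle (List.mem_flatten.2 ⟨w, hw, ha⟩)) hNw (h'.2.2.2.2.2 w hw)
    obtain ⟨s, t, rfl⟩ := List.append_of_mem hw
    have hN := h'.2.1 (n + 1)
    rw [if_pos (by simp), List.flatten_append, List.flatten_cons, List.count_append,
      List.count_append, hNw] at hN
    have hs : n + 1 ∉ s.flatten := List.count_eq_zero.1 (by omega)
    have ht : n + 1 ∉ t.flatten := List.count_eq_zero.1 (by omega)
    have hlt : ∀ a ∈ (s ++ (u ++ v) :: t).flatten, a < n + 1 := by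
      intro a ha
      refine lt_of_le_of_ne (hle ?_) ?_
      · simp only [List.flatten_append, List.flatten_cons, List.mem_append, List.mem_cons] at ha ⊢
        tauto
      · rintro rfl
        simp only [List.flatten_append, List.flatten_cons, List.mem_append] at ha huv
        tauto
    -- If the cycle begins with the maximum `n + 1`, minimality of its first letter forces it to be
    -- `(n + 1, n + 1)`, and the increasing order of cycles makes it the last one.
    rcases u with _ | ⟨b, u⟩
    · have hv : v = [] := by
        refine List.eq_nil_iff_forall_not_mem.2 fun a ha => ?_
        have h1 := h.min_first _ hw a (by simp [ha])
        have h2 := hlt a (by simp [ha])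
        simp only [List.nil_append, List.headI_cons] at h1
        omega
      subst hv
      have ht' : t = [] := by
        refine List.eq_nil_iff_forall_not_mem.2 fun d hd => ?_
        have h1 := (List.pairwise_cons.1 (List.pairwise_append.1 h.increasing).2.1).1 d hd
        have h2 := h.cycle_ne_nil d (by simp [hd])
        obtain ⟨b, d, rfl⟩ := List.exists_cons_of_ne_nil h2
        have h3 := hle (a := b) (List.mem_flatten.2 ⟨b :: d, by simp [hd], by simp⟩)
        simp only [List.nil_append, List.headI_cons] at h1
        omega
      subst ht'
      refine ⟨s, (isStirlingPerm₂_append_iff fun a ha => hlt a ?_).1 h, ?_⟩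
      · simpa using ha
      · exact mem_insertCycle.2 (Or.inl rfl)
    · refine ⟨_, (isStirlingPerm₂_insert_iff (by simp) hlt).1 h, ?_⟩
      exact mem_insertCycle.2 (Or.inr ⟨s, _, t, _, rfl,
        mem_insertWord.2 ⟨_, _, by simp, rfl, rfl⟩, rfl⟩)
  · rintro ⟨σ, h, hτ⟩
    have hlt : ∀ a ∈ σ.flatten, a < n + 1 := fun a ha =>
      Nat.lt_succ_of_le (h.mem_flatten_iff.1 ha).2
    rcases mem_insertCycle.1 hτ with rfl | ⟨s, c, t, w, rfl, hw, rfl⟩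
    · exact (isStirlingPerm₂_append_iff hlt).2 h
    · obtain ⟨u, v, hu, rfl, rfl⟩ := mem_insertWord.1 hw
      exact (isStirlingPerm₂_insert_iff hu hlt).2 h

theorem stirlingPerms₂_zero : stirlingPerms₂ 0 = {[]} := by
  ext σ
  rw [mem_stirlingPerms₂, Finset.mem_singleton]
  constructor
  · intro h
    refine List.eq_nil_iff_forall_not_mem.2 fun c hc => ?_
    obtain ⟨a, c, rfl⟩ := List.exists_cons_of_ne_nil (h.cycle_ne_nil c hc)
    have := h.mem_flatten_iff.1 (List.mem_flatten.2 ⟨_, hc, List.mem_cons_self⟩)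
    omega
  · rintro rfl
    exact isStirlingPerm₂_iff.2 (by simp)

theorem IsStirlingPerm₂.cap_le {n : ℕ} {σ : List (List ℕ)} (h : IsStirlingPerm₂ n σ) :
    cap σ ≤ n := by
  -- Only the count of slots is used; the universe of the discarded sum formula is arbitrary.
  obtain ⟨m, hm, -⟩ := sum_insertCycle.{0} (N := n + 1) fun a ha =>
    Nat.lt_succ_of_le (h.mem_flatten_iff.1 ha).2
  rw [h.length_flatten] at hm
  omega

/-- The weight `φ` is arbitrary so that the rule serves both monomials in `x, q` and products of
power series. -/
theorem sum_stirlingPerms₂_succ (n : ℕ) {M : Type*} [AddCommMonoid M] (φ : ℕ → ℕ → M) :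
    ∑ τ ∈ stirlingPerms₂ (n + 1), φ (cap τ) (cyc τ) =
      ∑ σ ∈ stirlingPerms₂ n, (φ (cap σ) (cyc σ + 1) + (2 * cap σ) • φ (cap σ) (cyc σ) +
        (2 * (n - cap σ)) • φ (cap σ + 1) (cyc σ)) := by
  have hlt : ∀ σ ∈ stirlingPerms₂ n, ∀ a ∈ σ.flatten, a < n + 1 := fun σ hσ a ha =>
    Nat.lt_succ_of_le ((mem_stirlingPerms₂.1 hσ).mem_flatten_iff.1 ha).2
  have hnot : ∀ σ ∈ stirlingPerms₂ n, n + 1 ∉ σ.flatten := fun σ hσ h =>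
    lt_irrefl _ (hlt σ hσ _ h)
  have hU : stirlingPerms₂ (n + 1) =
      (stirlingPerms₂ n).biUnion fun σ => (insertCycle (n + 1) σ).toFinset := by
    ext τ
    simp only [mem_stirlingPerms₂, isStirlingPerm₂_succ_iff, Finset.mem_biUnion, List.mem_toFinset]
  rw [hU, Finset.sum_biUnion]
  · refine Finset.sum_congr rfl fun σ hσ => ?_
    rw [List.sum_toFinset _ (nodup_insertCycle (hnot σ hσ))]
    obtain ⟨m, hm, H⟩ := sum_insertCycle (hlt σ hσ)
    rw [(mem_stirlingPerms₂.1 hσ).length_flatten] at hm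
    rw [H, show m = 2 * (n - cap σ) by omega]
  · intro σ hσ σ' hσ' hne
    refine Finset.disjoint_left.2 fun τ h h' => hne ?_
    rw [List.mem_toFinset] at h h'
    rw [← removeLetter_of_mem_insertCycle (hnot σ hσ) (mem_stirlingPerms₂.1 hσ).cycle_ne_nil h,
      removeLetter_of_mem_insertCycle (hnot σ' hσ') (mem_stirlingPerms₂.1 hσ').cycle_ne_nil h']

/-! ### Formal powers and their derivatives -/

open PowerSeries

/-- This is the coefficient form of $(1+X)B'=aB$ for the binomial series $B$. -/
theorem succ_mul_choose_succ {K : Type*} [Field K] [CharZero K] (a : K) (n : ℕ) :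
    ((n : K) + 1) * Ring.choose a (n + 1) = (a - n) * Ring.choose a n := by
  have h : ((n.factorial : ℕ) : K) ≠ 0 := by exact_mod_cast n.factorial_ne_zero
  have h1 := Ring.descPochhammer_eq_factorial_smul_choose a (n + 1)
  rw [descPochhammer_succ_right, Polynomial.smeval_mul, 
    Ring.descPochhammer_eq_factorial_smul_choose] at h1
  simp only [Polynomial.smeval_sub, Polynomial.smeval_X, Polynomial.smeval_natCast, pow_one,
    pow_zero, nsmul_eq_mul, mul_one, Nat.factorial_succ, Nat.cast_mul, Nat.cast_add,
    Nat.cast_one] at h1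
  apply mul_left_cancel₀ h
  linear_combination -h1

theorem one_add_X_mul_derivative_binomialSeries {K : Type*} [Field K] [CharZero K] (a : K) :
    (1 + X) * d⁄dX K (binomialSeries K a) = C a * binomialSeries K a := by
  ext n
  rw [add_mul, one_mul, map_add, coeff_C_mul]
  cases n with
  | zero => simp [coeff_derivative]
  | succ n =>
    rw [coeff_succ_X_mul, coeff_derivative, coeff_derivative]
    simp only [binomialSeries_coeff, smul_eq_mul, mul_one]
    have := succ_mul_choose_succ a (n + 1)
    push_cast at this ⊢
    linear_combination this

theorem hasSubst_sub_one {K : Type*} [Field K] {F : PowerSeries K} (hF : constantCoeff F = 1) :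
    HasSubst (F - 1) :=
  HasSubst.of_constantCoeff_zero' (by simp [hF])

theorem constantCoeff_formalPow {K : Type*} [Field K] [CharZero K] {F : PowerSeries K}
    (hF : constantCoeff F = 1) (a : K) : constantCoeff (formalPow F a) = 1 := by
  have h : constantCoeff (F - 1) = 0 := by simp [hF]
  have := constantCoeff_subst_eq_zero h (binomialSeries K a - 1) (by simp)
  rw [← coe_substAlgHom (hasSubst_sub_one hF), map_sub, map_one, map_sub, map_one,
    sub_eq_zero] at this
  rwa [coe_substAlgHom] at this

/-- Together with `formalPow_one`, this makes `formalPow H 2⁻¹` a square root of `H`. -/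
theorem formalPow_add {K : Type*} [Field K] [CharZero K] {F : PowerSeries K}
    (hF : constantCoeff F = 1) (a b : K) :
    formalPow F (a + b) = formalPow F a * formalPow F b := by
  rw [formalPow, binomialSeries_add, subst_mul (hasSubst_sub_one hF)]
  rfl

theorem formalPow_one {K : Type*} [Field K] [CharZero K] {F : PowerSeries K}
    (hF : constantCoeff F = 1) : formalPow F 1 = F := by
  have h := binomialSeries_nat (R := K) (A := K) 1
  rw [Nat.cast_one, pow_one] at h
  rw [formalPow, h, subst_add (hasSubst_sub_one hF), subst_X (hasSubst_sub_one hF)]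
  rw [← coe_substAlgHom (hasSubst_sub_one hF), map_one]
  ring

/-- Substitute $F-1$ for $X$ in the differential equation of the binomial series and apply the chain
rule. -/
theorem mul_derivative_formalPow {K : Type*} [Field K] [CharZero K] {F : PowerSeries K}
    (hF : constantCoeff F = 1) (a : K) :
    F * d⁄dX K (formalPow F a) = C a * formalPow F a * d⁄dX K F := by
  have hs := hasSubst_sub_one hF
  have h := congrArg (substAlgHom hs) (one_add_X_mul_derivative_binomialSeries a)
  simp only [map_mul, map_add, map_one, substAlgHom_X] at h
  rw [coe_substAlgHom hs, subst_C, add_sub_cancel] at h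
  have hd : d⁄dX K (F - 1) = d⁄dX K F := by rw [map_sub, derivative_one, sub_zero]
  rw [formalPow, derivative_subst hs, hd, ← mul_assoc, h]
  rfl

theorem derivative_rescale_exp {K : Type*} [Field K] [CharZero K] (a : K) :
    d⁄dX K (rescale a (exp K)) = C a * rescale a (exp K) := by
  ext n
  rw [coeff_derivative, coeff_C_mul, coeff_rescale, coeff_rescale]
  have := congrArg (coeff n) (derivative_exp K)
  rw [coeff_derivative] at this
  rw [← this]
  ring

/-! ### The recurrence and the generating function -/

theorem Q_zero : Q 0 = 1 := by
  simp [Q, stirlingPerms₂_zero, cap, cyc]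

theorem Q_succ (n : ℕ) : Q (n + 1) =
    (MvPolynomial.X 1 + 2 * (n : MvPolynomial (Fin 2) ℤ) * MvPolynomial.X 0) * Q n +
      2 * MvPolynomial.X 0 * (1 - MvPolynomial.X 0) * MvPolynomial.pderiv 0 (Q n) := by
  rw [Q, sum_stirlingPerms₂_succ n fun i j =>
    (MvPolynomial.X 0 ^ i * MvPolynomial.X 1 ^ j : MvPolynomial (Fin 2) ℤ), Q, map_sum,
    Finset.mul_sum, Finset.mul_sum, ← Finset.sum_add_distrib]
  refine Finset.sum_congr rfl fun σ hσ => ?_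
  have hle := (mem_stirlingPerms₂.1 hσ).cap_le
  obtain ⟨m, rfl⟩ := Nat.exists_eq_add_of_le hle
  generalize cyc σ = j
  generalize cap σ = i
  rw [Nat.add_sub_cancel_left]
  -- The extra factor $x$ makes $x\,\partial_x$ act on monomials by their degree in $x$, avoiding
  -- the exponent `i - 1`.
  have h0 : MvPolynomial.X 0 * MvPolynomial.pderiv 0
      (MvPolynomial.X 0 ^ i * MvPolynomial.X 1 ^ j : MvPolynomial (Fin 2) ℤ) =
      (i : MvPolynomial (Fin 2) ℤ) * (MvPolynomial.X 0 ^ i * MvPolynomial.X 1 ^ j) := by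
    rw [Derivation.leibniz, Derivation.leibniz_pow, Derivation.leibniz_pow]
    simp only [MvPolynomial.pderiv_X_self,
      MvPolynomial.pderiv_X_of_ne (show (1 : Fin 2) ≠ 0 by simp), smul_eq_mul, nsmul_eq_mul, mul_one]
    cases i with
    | zero => simp
    | succ i => simp only [Nat.add_sub_cancel]; ring
  simp only [nsmul_eq_mul]
  push_cast
  linear_combination -2 * (1 - MvPolynomial.X 0) * h0

/-- Iterated derivatives of a solution of `G' = q G v`, where `u' = v' = 2 u v`. -/
theorem iterate_derivative_eq {K : Type*} [Field K] {q : K} {u v G : PowerSeries K}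
    (hu : d⁄dX K u = 2 * u * v) (hv : d⁄dX K v = 2 * u * v) (hG : d⁄dX K G = C q * G * v) (n : ℕ) :
    (d⁄dX K)^[n] G =
      G * ∑ σ ∈ stirlingPerms₂ n, u ^ cap σ * v ^ (n - cap σ) * C q ^ cyc σ := by
  induction n with
  | zero => simp [stirlingPerms₂_zero, cap, cyc]
  | succ n ih =>
    -- The product rule mirrors insertion: differentiating `G` adds a cycle, a factor `u` stands for
    -- two slots keeping `cap`, and a factor `v` for two slots raising it.
    rw [Function.iterate_succ_apply', ih, sum_stirlingPerms₂_succ n fun i j =>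
      u ^ i * v ^ (n + 1 - i) * C q ^ j, Finset.mul_sum, Finset.mul_sum, map_sum]
    refine Finset.sum_congr rfl fun σ hσ => ?_
    have hle := (mem_stirlingPerms₂.1 hσ).cap_le
    obtain ⟨m, rfl⟩ := Nat.exists_eq_add_of_le hle
    generalize cyc σ = j
    generalize cap σ = i
    have hq : d⁄dX K (C q ^ j) = 0 := by rw [← map_pow, derivative_C]
    have hui : d⁄dX K (u ^ i) = 2 * i * u ^ i * v := by
      rw [derivative_pow, hu]
      cases i with
      | zero => simp
      | succ i => simp only [Nat.add_sub_cancel]; ring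
    have hvm : d⁄dX K (v ^ m) = 2 * m * u * v ^ m := by
      rw [derivative_pow, hv]
      cases m with
      | zero => simp
      | succ m => simp only [Nat.add_sub_cancel]; ring
    rw [show i + m - i = m by omega, show i + m + 1 - i = m + 1 by omega,
      show i + m + 1 - (i + 1) = m by omega]
    simp only [Derivation.leibniz, smul_eq_mul, hq, hui, hvm, hG, nsmul_eq_mul]
    push_cast
    ring

theorem egf_eq_of_derivative {K : Type*} [Field K] [CharZero K] {x q : K} {u v G : PowerSeries K}
    (hu : d⁄dX K u = 2 * u * v) (hv : d⁄dX K v = 2 * u * v) (hG : d⁄dX K G = C q * G * v)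
    (hu0 : constantCoeff u = x) (hv0 : constantCoeff v = 1) (hG0 : constantCoeff G = 1) :
    egf x q = G := by
  ext n
  have hn : (n.factorial : K) ≠ 0 := by exact_mod_cast n.factorial_ne_zero
  have h := constantCoeff_iterate_derivative G n
  rw [iterate_derivative_eq hu hv hG] at h
  rw [egf, coeff_mk, div_eq_iff hn, mul_comm, ← h]
  simp [Q, hu0, hv0, hG0]

theorem exists_sqrt_egf_eq_formalPow {K : Type*} [Field K] [CharZero K] (x q : K) (hx : x ≠ 1) :
    ∃ S : PowerSeries K, constantCoeff S = 1 ∧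
      S ^ 2 = C (x - 1) * (C x - rescale (2 * (x - 1)) (exp K))⁻¹ ∧
      egf x q = formalPow S q := by
  set E := rescale (2 * (x - 1)) (exp K) with hE
  set H := C (x - 1) * (C x - E)⁻¹ with hH
  have hx' : x - 1 ≠ 0 := sub_ne_zero.2 hx
  have hE0 : constantCoeff E = 1 := by simp [hE, ← coeff_zero_eq_constantCoeff_apply, coeff_rescale]
  have hD0 : constantCoeff (C x - E) = x - 1 := by simp [hE0]
  -- Here $x\ne1$ is essential: the constant term $x-1$ must be invertible.
  have hinv : (C x - E) * (C x - E)⁻¹ = 1 := PowerSeries.mul_inv_cancel _ (by rwa [hD0])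
  have hH0 : constantCoeff H = 1 := by
    rw [hH, map_mul, constantCoeff_inv, hD0, constantCoeff_C, mul_inv_cancel₀ hx']
  -- This eliminates the exponential from $H'=2H\cdot HE$, leaving a differential equation in $H$
  -- alone.
  have hHE : H * E = C x * H - C (x - 1) := by
    rw [hH]; linear_combination -C (x - 1) * hinv
  have hH' : d⁄dX K H = 2 * H * (1 - C x + C x * H) := by
    have hE' : d⁄dX K E = 2 * C (x - 1) * E := by
      rw [hE, derivative_rescale_exp, map_mul]; rfl
    have h1 : d⁄dX K H = 2 * H * (H * E) := by
      rw [hH, Derivation.leibniz, derivative_inv', map_sub (d⁄dX K), derivative_C,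
        derivative_C, hE']
      simp only [smul_eq_mul]
      ring
    rw [h1, hHE, map_sub, map_one]
    ring
  set S := formalPow H 2⁻¹ with hS
  have hS0 : constantCoeff S = 1 := constantCoeff_formalPow hH0 _
  have hSS : S ^ 2 = H := by
    rw [sq, hS, ← formalPow_add hH0, show (2⁻¹ : K) + 2⁻¹ = 1 by norm_num, formalPow_one hH0]
  refine ⟨S, hS0, hSS, ?_⟩
  have hSne : S ≠ 0 := fun h => by simp [h] at hS0
  have hS' : d⁄dX K S = S * (1 - C x + C x * H) := by
    have h := congrArg (d⁄dX K) hSS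
    rw [derivative_pow, hH', ← hSS] at h
    have h2 : (2 : PowerSeries K) * S ≠ 0 := 
      mul_ne_zero (fun h => two_ne_zero (α := K) ((map_ofNat constantCoeff 2).symm.trans
        ((congrArg constantCoeff h).trans (map_zero _)))) hSne
    apply mul_left_cancel₀ h2
    rw [← hSS]
    norm_num at h
    linear_combination h
  -- The series `v` is $HE$, the logarithmic derivative of `S`; `u` and `v` differ by a constant, so
  -- $u'=v'$.
  refine egf_eq_of_derivative (u := C x * H) (v := 1 - C x + C x * H) ?_ ?_ ?_ ?_ ?_
    (constantCoeff_formalPow hS0 q)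
  · rw [Derivation.leibniz, derivative_C, hH']
    simp only [smul_eq_mul]
    ring
  · rw [map_add, map_sub, derivative_one, derivative_C, Derivation.leibniz, derivative_C, hH']
    simp only [smul_eq_mul]
    ring
  · apply mul_left_cancel₀ hSne
    rw [mul_derivative_formalPow hS0, hS']
    ring
  · simp [hH0]
  · simp [hH0]

end StirlingSecond

theorem mainTheorem2 :
    (StirlingSecond.Q 0 = 1) ∧
    (∀ n : ℕ, StirlingSecond.Q (n + 1) =
      (MvPolynomial.X 1 + 2 * (n : MvPolynomial (Fin 2) ℤ) * MvPolynomial.X 0) *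
          StirlingSecond.Q n +
        2 * MvPolynomial.X 0 * (1 - MvPolynomial.X 0) *
          MvPolynomial.pderiv 0 (StirlingSecond.Q n)) ∧
    (∀ (K : Type*) [Field K] [CharZero K] (x q : K), x ≠ 1 →
      ∃ S : PowerSeries K,
        PowerSeries.constantCoeff S = 1 ∧
        S ^ 2 = PowerSeries.C (x - 1) *
          (PowerSeries.C x - PowerSeries.rescale (2 * (x - 1)) (PowerSeries.exp K))⁻¹ ∧
        StirlingSecond.egf x q = StirlingSecond.formalPow S q) :=
  ⟨StirlingSecond.Q_zero, StirlingSecond.Q_succ, fun _ _ _ x q hx =>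
    StirlingSecond.exists_sqrt_egf_eq_formalPow x q hx⟩
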